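/- Facet system verification. Here $\dim$ denotes the dimension of the affine hull. Consider the following recursive algorithm $\mathtt{fsv}(P;\{F_1,\dots,F_q\})$, whose input is a polytope $P\subset\mathbb{R}^d$ with $\dim(P)\ge 1$, given by its finite set of vertices, together with $q$ distinct nonempty proper faces $F_1,\dots,F_q$ of $P$, no two comparable for inclusion, each given by its set of vertices. For distinct indices $i,j\in\{1,\dots,q\}$ write $i\sim j$ if there is no index $k\in\{1,\dots,q\}\setminus\{i,j\}$ with $F_i\cap F_j\subseteq F_k$. 1. If $\dim(P)=1$: return `accept' if $q=2$, and `reject' otherwise. 2. If $q<\dim(P)+1$: return `reject'. 3. For $i=1,\dots,q$: if $\dim(F_i)<\dim(P)-1$, or if $\mathtt{fsv}(F_i;\{F_i\cap F_j \mid i\sim j\})$ returns `reject', then return `reject'. 4. Return `accept'. Theorem. Let $P\subset\mathbb{R}^d$ be a polytope with $\dim(P)\ge 1$, and let $\{F_1,\dots,F_q\}$ be a finite (possibly empty) collection of nonempty proper faces of $P$, no two of which are comparable for inclusion. Then $\mathtt{fsv}(P;\{F_1,\dots,F_q\})$ returns `accept' if $\{F_1,\dots,F_q\}$ is the collection of all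 facets of $P$ (faces of dimension $\dim(P)-1$), and returns `reject' otherwise. -/

import Mathlib

namespace FSV

/-- Euclidean `d`-space. -/
abbrev E (d : ℕ) := EuclideanSpace ℝ (Fin d)

/-- A (convex) polytope: the convex hull of a finite set of points. -/
def IsPolytope {d : ℕ} (P : Set (E d)) : Prop :=
  ∃ s : Finset (E d), P = convexHull ℝ (s : Set (E d))

/-- The dimension of a nonempty set, i.e. the dimension of its affine hull (the value at the
empty set is the junk value `0`). -/
noncomputable def dim {d : ℕ} (S : Set (E d)) : ℕ :=
  Module.finrank ℝ (vectorSpan ℝ S)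

/-- Passing to the convex hull does not change the dimension; in particular the dimension of a
polytope can be read off from its vertex set. -/
theorem dim_convexHull {d : ℕ} (S : Set (E d)) : dim (convexHull ℝ S) = dim S := by
  unfold dim
  rw [← direction_affineSpan, affineSpan_convexHull, direction_affineSpan]

/-- `F` is a face of `P`: it is empty, or the set of maximizers over `P` of a linear functional
(`P` itself is the face given by the zero functional). -/
def IsFace {d : ℕ} (P F : Set (E d)) : Prop :=
  IsExposed ℝ P F

/-- `F` is a facet of `P`: a nonempty face of dimension `dim P - 1`. -/
def IsFacet {d : ℕ} (P F : Set (E d)) : Prop :=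
  IsFace P F ∧ F.Nonempty ∧ dim F + 1 = dim P

open Classical in
/-- The finite vertex set of a polytope (junk value `∅` for a set with infinitely many extreme
points, which a polytope never has, see `coe_vert`). -/
noncomputable def vert {d : ℕ} (P : Set (E d)) : Finset (E d) :=
  if h : (P.extremePoints ℝ).Finite then h.toFinset else ∅

theorem coe_vert {d : ℕ} {P : Set (E d)} (hP : IsPolytope P) :
    (vert P : Set (E d)) = P.extremePoints ℝ := by
  obtain ⟨s, rfl⟩ := hP
  have h : ((convexHull ℝ (s : Set (E d))).extremePoints ℝ).Finite :=
    s.finite_toSet.subset extremePoints_convexHull_subset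
  simp [vert, h]

/-- The two possible outputs of the algorithm. -/
inductive Verdict where
  | accept : Verdict
  | reject : Verdict

/-- For members `F = F_i`, `G = F_j` of the collection `𝓕`, the relation `i ∼ j`: the two are
distinct, and no third member of `𝓕` contains `F ∩ G`. -/
def Adj {α : Type*} [DecidableEq α] (𝓕 : Finset (Finset α)) (F G : Finset α) : Prop :=
  F ≠ G ∧ ¬ ∃ K ∈ 𝓕, K ≠ F ∧ K ≠ G ∧ F ∩ G ⊆ K

open Classical in
/-- The collection `{F_i ∩ F_j | i ∼ j}`, where `F = F_i`. -/
noncomputable def traces {α : Type*} (𝓕 : Finset (Finset α)) (F : Finset α) :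
    Finset (Finset α) :=
  (𝓕.filter fun G => Adj 𝓕 F G).image fun G => F ∩ G

open Classical in
/-- The recursive facet system verification algorithm. A polytope is passed as its finite set `V`
of vertices, and a collection of faces as the collection `𝓕` of their vertex sets. The test
`F ⊂ V` only guarantees termination: it holds by the input contract, which says that the
members of `𝓕` are proper faces and pairwise incomparable, in the call itself and in all recursive
calls (see `fsv_eq`, `ssubset_of_mem_traces` and `isAntichain_traces`). -/
noncomputable def fsv {d : ℕ} (V : Finset (E d)) (𝓕 : Finset (Finset (E d))) : Verdict :=
  if dim (V : Set (E d)) = 1 then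
    if 𝓕.card = 2 then .accept else .reject
  else if 𝓕.card < dim (V : Set (E d)) + 1 then
    .reject
  else if ∃ F ∈ 𝓕, dim (F : Set (E d)) + 1 < dim (V : Set (E d)) ∨
      (if _h : F ⊂ V then fsv F (traces 𝓕 F) else .reject) = .reject then
    .reject
  else
    .accept
termination_by V.card
decreasing_by all_goals exact Finset.card_lt_card (by assumption)

open Classical in
/-- On collections of proper subsets, `fsv` satisfies the unguarded recursion. -/
theorem fsv_eq {d : ℕ} (V : Finset (E d)) (𝓕 : Finset (Finset (E d))) (h : ∀ F ∈ 𝓕, F ⊂ V) :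
    fsv V 𝓕 =
      if dim (V : Set (E d)) = 1 then
        if 𝓕.card = 2 then .accept else .reject
      else if 𝓕.card < dim (V : Set (E d)) + 1 then
        .reject
      else if ∃ F ∈ 𝓕, dim (F : Set (E d)) + 1 < dim (V : Set (E d)) ∨
          fsv F (traces 𝓕 F) = .reject then
        .reject
      else
        .accept := by
  have key : (∃ F ∈ 𝓕, dim (F : Set (E d)) + 1 < dim (V : Set (E d)) ∨
      (if _h : F ⊂ V then fsv F (traces 𝓕 F) else .reject) = .reject) ↔
      ∃ F ∈ 𝓕, dim (F : Set (E d)) + 1 < dim (V : Set (E d)) ∨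
          fsv F (traces 𝓕 F) = .reject := by
    refine exists_congr fun F => and_congr_right fun hF => ?_
    rw [dif_pos (h F hF)]
  rw [fsv]
  simp only [key]

/-- The collection passed to a recursive call again consists of proper subsets. -/
theorem ssubset_of_mem_traces {α : Type*} {𝓕 : Finset (Finset α)}
    (h𝓕 : IsAntichain (· ⊆ ·) (𝓕 : Set (Finset α))) {F : Finset α} (hF : F ∈ 𝓕) :
    ∀ G ∈ traces 𝓕 F, G ⊂ F := by
  classical
  intro G hG
  simp only [traces, Finset.mem_image, Finset.mem_filter] at hG
  obtain ⟨K, ⟨hK, hadj⟩, rfl⟩ := hG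
  refine Finset.ssubset_iff_subset_ne.2 ⟨Finset.inter_subset_left, fun h => ?_⟩
  exact h𝓕 hF hK hadj.1 (Finset.inter_eq_left.1 h)

/-- The collection passed to a recursive call is again an antichain. -/
theorem isAntichain_traces {α : Type*} (𝓕 : Finset (Finset α)) (F : Finset α) :
    IsAntichain (· ⊆ ·) (traces 𝓕 F : Set (Finset α)) := by
  classical
  intro G hG G' hG' hne hsub
  simp only [traces, Finset.coe_image, Set.mem_image, Finset.mem_coe, Finset.mem_filter] at hG hG'
  obtain ⟨K, ⟨hK, hadj⟩, rfl⟩ := hG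
  obtain ⟨K', ⟨hK', hadj'⟩, rfl⟩ := hG'
  refine hadj.2 ⟨K', hK', hadj'.1.symm, ?_, hsub.trans Finset.inter_subset_right⟩
  rintro rfl
  exact hne (by congr)

open Classical in
/-- The collection of vertex sets of the members of a collection of faces. -/
noncomputable def vertSets {d : ℕ} (𝓕 : Finset (Set (E d))) : Finset (Finset (E d)) :=
  𝓕.image vert

end FSV

/-!
Faces of a polytope `P` are described by affine functionals that are nonnegative on `P`: a nonempty
face is the zero set in `P` of such a functional (`zeroFace`). The facts about facets that are
needed come from tilting a supporting hyperplane until it hits a further vertex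
(`IsPolytope.exists_tilt`):

* a polytope is cut out of its affine hull by its facet-defining inequalities, and each proper face
  lies in a facet (`IsPolytope.exists_isFacet_of_notMem`, `IsPolytope.exists_isFacet_superset`);
* each ridge lies in exactly two facets, and is their intersection
  (`IsPolytope.exists_isFacet_inter_eq`, `IsFacet.eq_of_ridge_subset`);
* there are at least `dim P + 1` facets (`IsPolytope.dim_lt_card_facets`).

The correctness of the algorithm is proved by induction on the dimension. If the collection consists
of all facets, the sets `F ∩ G` with `F ∼ G` are exactly the ridges in `F`: a proper face `F ∩ G`
of `F` lies in a ridge `F ∩ K`, and `F ∼ G` forces `K = G`. So all recursive calls accept.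

Conversely, if the algorithm accepts in dimension at least two, the members of the collection are
facets, and by induction each ridge `R` of a member `F` is a trace `F ∩ G` with `G` in the
collection. Thus the collection is nonempty and closed under passing to the neighbor of a facet
across a ridge. Since the facets are connected through ridges
(`IsPolytope.mem_of_isFacet_of_closed`), it contains all facets. Connectedness is shown by the
argument of the simplex method for the polar polytope: the member of the collection whose normalized
functional is smallest at a relative interior point of a facet `G` has no neighbor where it is
smaller, which forces it to be `G`.
-/

namespace FSV

variable {d : ℕ}

/-! ### Affine functionals and dimension -/

theorem eq_zero_of_mem_affineSpan {g : E d →ᵃ[ℝ] ℝ} {S : Set (E d)} (h : ∀ y ∈ S, g y = 0)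
    {x : E d} (hx : x ∈ affineSpan ℝ S) : g x = 0 := by
  refine affineSpan_induction (p := fun x => g x = 0) hx h fun c u v w hu hv hw => ?_
  rw [AffineMap.map_vadd, map_smul, AffineMap.linearMap_vsub, hu, hv, hw]
  simp

theorem map_add_smul (g : E d →ᵃ[ℝ] ℝ) (x v : E d) (t : ℝ) :
    g (x + t • v) = g x + t * g.linear v := by
  have := g.map_vadd x (t • v)
  simp only [vadd_eq_add, map_smul, smul_eq_mul] at this
  rw [add_comm x, this, add_comm]

theorem add_smul_apply (g m : E d →ᵃ[ℝ] ℝ) (t : ℝ) (x : E d) :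
    (g + t • m) x = g x + t * m x :=
  rfl

theorem linear_sub (g : E d →ᵃ[ℝ] ℝ) (x y : E d) : g.linear (x - y) = g x - g y :=
  g.linearMap_vsub x y

theorem add_smul_mem_affineSpan {S : Set (E d)} {x v : E d} (hx : x ∈ affineSpan ℝ S)
    (hv : v ∈ vectorSpan ℝ S) (t : ℝ) : x + t • v ∈ affineSpan ℝ S := by
  have := vadd_mem_affineSpan_of_mem_affineSpan_of_mem_vectorSpan hx (Submodule.smul_mem _ t hv)
  rwa [vadd_eq_add, add_comm] at this

theorem dim_mono {S T : Set (E d)} (h : S ⊆ T) : dim S ≤ dim T :=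
  Submodule.finrank_mono (vectorSpan_mono ℝ h)

theorem affineSpan_eq_of_dim_le {S T : Set (E d)} (hS : S.Nonempty)
    (hST : S ⊆ affineSpan ℝ T) (h : dim T ≤ dim S) : affineSpan ℝ S = affineSpan ℝ T := by
  have hle : affineSpan ℝ S ≤ affineSpan ℝ T := affineSpan_le.2 hST
  refine AffineSubspace.eq_of_direction_eq_of_nonempty_of_le ?_ (hS.affineSpan ℝ) hle
  refine Submodule.eq_of_le_of_finrank_le (AffineSubspace.direction_le hle) ?_
  rwa [direction_affineSpan, direction_affineSpan]

theorem dim_insert_le (S : Set (E d)) (x : E d) : dim (insert x S) ≤ dim S + 1 :=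
  finrank_vectorSpan_insert_le_set ℝ S x

theorem dim_lt_dim_insert {S : Set (E d)} (hS : S.Nonempty) {x : E d}
    (hx : x ∉ affineSpan ℝ S) : dim S < dim (insert x S) := by
  by_contra! h
  refine hx ?_
  rw [affineSpan_eq_of_dim_le hS ((Set.subset_insert x S).trans (subset_affineSpan ℝ _)) h]
  exact mem_affineSpan ℝ (Set.mem_insert _ _)

/-- If `S` has codimension one in `T`, then any point of the affine hull of `T` outside that of `S`
spans the former together with `S`. -/
theorem affineSpan_insert_eq {S T : Set (E d)} (hS : S.Nonempty) (hST : S ⊆ T)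
    (hdim : dim T ≤ dim S + 1) {x : E d} (hxT : x ∈ affineSpan ℝ T) (hx : x ∉ affineSpan ℝ S) :
    affineSpan ℝ (insert x S) = affineSpan ℝ T :=
  affineSpan_eq_of_dim_le (Set.insert_nonempty _ _)
    (Set.insert_subset hxT (hST.trans (subset_affineSpan ℝ T)))
    (hdim.trans (dim_lt_dim_insert hS hx))

/-- The affine functionals on the affine hull of `T` that vanish on a subset of codimension one
are proportional. -/
theorem mul_apply_eq_mul_apply {S T : Set (E d)} (hS : S.Nonempty) (hST : S ⊆ T)
    (hdim : dim T ≤ dim S + 1) {h k : E d →ᵃ[ℝ] ℝ} (hh : ∀ y ∈ S, h y = 0)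
    (hk : ∀ y ∈ S, k y = 0) {z : E d} (hz : z ∈ affineSpan ℝ T) (hz0 : h z ≠ 0) {x : E d}
    (hx : x ∈ affineSpan ℝ T) : h z * k x = k z * h x := by
  have hzS : z ∉ affineSpan ℝ S := fun hzS => hz0 (eq_zero_of_mem_affineSpan hh hzS)
  rw [← affineSpan_insert_eq hS hST hdim hz hzS] at hx
  have key := eq_zero_of_mem_affineSpan (g := h z • k - k z • h) (S := insert z S) ?_ hx
  · simpa [sub_eq_zero] using key
  · rintro y (rfl | hy)
    · simp [mul_comm]
    · simp [hh y hy, hk y hy]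

/-- An affine subspace not containing `y` is contained in a hyperplane not containing `y`. -/
theorem exists_affineMap_eq_zero_of_notMem {S : Set (E d)} {y : E d} (hS : S.Nonempty)
    (hy : y ∉ affineSpan ℝ S) : ∃ b : E d →ᵃ[ℝ] ℝ, (∀ x ∈ S, b x = 0) ∧ b y ≠ 0 := by
  obtain ⟨p, hp⟩ := hS
  have hpS := mem_affineSpan ℝ hp
  have hv : y - p ∉ vectorSpan ℝ S := fun h => hy <| by
    simpa using add_smul_mem_affineSpan hpS h 1
  obtain ⟨f, hf, hle⟩ := Submodule.exists_le_ker_of_notMem hv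
  refine ⟨f.toAffineMap - AffineMap.const ℝ _ (f p), fun x hx => ?_, ?_⟩
  · have := hle (vsub_mem_vectorSpan ℝ hx hp)
    simpa using this
  · simpa using hf

/-! ### Faces as zero sets of nonnegative affine functionals -/

/-- The set of zeros of `g` in `P`. When `g` is nonnegative on `P`, this is a face of `P`, and every
nonempty face arises in this way. -/
def zeroFace (P : Set (E d)) (g : E d →ᵃ[ℝ] ℝ) : Set (E d) :=
  {x ∈ P | g x = 0}

theorem zeroFace_subset (P : Set (E d)) (g : E d →ᵃ[ℝ] ℝ) : zeroFace P g ⊆ P :=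
  fun _ hx => hx.1

theorem IsFace.exists_eq_zeroFace {P F : Set (E d)} (hF : IsFace P F) (hne : F.Nonempty) :
    ∃ g : E d →ᵃ[ℝ] ℝ, (∀ x ∈ P, 0 ≤ g x) ∧ F = zeroFace P g := by
  obtain ⟨l, hl⟩ := hF hne
  obtain ⟨p, hp⟩ := hne
  have hp' := hp
  rw [hl] at hp'
  have hval : ∀ x, (AffineMap.const ℝ (E d) (l p) - (l : E d →ₗ[ℝ] ℝ).toAffineMap) x
      = l p - l x := fun x => by simp
  refine ⟨AffineMap.const ℝ (E d) (l p) - (l : E d →ₗ[ℝ] ℝ).toAffineMap, fun x hx => ?_, ?_⟩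
  · rw [hval]
    linarith [hp'.2 x hx]
  · ext x
    simp only [zeroFace, Set.mem_ofPred_eq, hval]
    constructor
    · intro hx
      rw [hl] at hx
      exact ⟨hx.1, by linarith [hx.2 p hp'.1, hp'.2 x hx.1]⟩
    · rintro ⟨hx, h0⟩
      rw [hl]
      exact ⟨hx, fun y hy => by linarith [hp'.2 y hy]⟩

theorem isFace_zeroFace {P : Set (E d)} {g : E d →ᵃ[ℝ] ℝ} (hg : ∀ x ∈ P, 0 ≤ g x) :
    IsFace P (zeroFace P g) := by
  rintro ⟨p, hpP, hp⟩
  have hval : ∀ x, (-LinearMap.toContinuousLinearMap g.linear : StrongDual ℝ (E d)) x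
      = g p - g x - g.linear p := fun x => by
    have := linear_sub g x p
    rw [map_sub] at this
    simp only [neg_apply, LinearMap.coe_toContinuousLinearMap']
    linarith
  refine ⟨-LinearMap.toContinuousLinearMap g.linear, ?_⟩
  ext x
  simp only [zeroFace, Set.mem_ofPred_eq, hval]
  constructor
  · rintro ⟨hx, h0⟩
    exact ⟨hx, fun y hy => by linarith [hg y hy]⟩
  · rintro ⟨hx, h⟩
    exact ⟨hx, by linarith [h p hpP, hg x hx]⟩

theorem IsFace.eq_of_subset_of_dim_le {P F G : Set (E d)} (hF : IsFace P F) (hFne : F.Nonempty)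
    (hGP : G ⊆ P) (hFG : F ⊆ G) (h : dim G ≤ dim F) : F = G := by
  obtain ⟨g, -, rfl⟩ := hF.exists_eq_zeroFace hFne
  refine hFG.antisymm fun x hx => ⟨hGP hx, ?_⟩
  refine eq_zero_of_mem_affineSpan (S := zeroFace P g) (fun y hy => hy.2) ?_
  rw [affineSpan_eq_of_dim_le hFne (hFG.trans (subset_affineSpan ℝ G)) h]
  exact mem_affineSpan ℝ hx

theorem IsFace.dim_lt {P F : Set (E d)} (hF : IsFace P F) (hFne : F.Nonempty) (hFP : F ≠ P) :
    dim F < dim P := by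
  by_contra! h
  exact hFP (hF.eq_of_subset_of_dim_le hFne subset_rfl hF.subset h)

theorem IsFacet.ne {P F : Set (E d)} (hF : IsFacet P F) : F ≠ P := by
  rintro rfl
  have := hF.2.2
  omega

/-- Facets are maximal among the proper faces. -/
theorem IsFacet.eq_of_subset {P F G : Set (E d)} (hF : IsFacet P F) (hG : IsFace P G)
    (hGP : G ≠ P) (hFG : F ⊆ G) : F = G := by
  refine hF.1.eq_of_subset_of_dim_le hF.2.1 hG.subset hFG ?_
  have := hG.dim_lt (hF.2.1.mono hFG) hGP
  have := hF.2.2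
  omega

/-- The affine hull of a facet is cut out of that of the polytope by a supporting hyperplane. -/
theorem mem_affineSpan_zeroFace {P : Set (E d)} {g : E d →ᵃ[ℝ] ℝ}
    (hF : IsFacet P (zeroFace P g)) {x : E d} (hx : x ∈ affineSpan ℝ P) (h0 : g x = 0) :
    x ∈ affineSpan ℝ (zeroFace P g) := by
  by_contra hxF
  have hsp := affineSpan_insert_eq hF.2.1 hF.1.subset hF.2.2.ge hx hxF
  refine hF.ne ((zeroFace_subset P g).antisymm fun y hy => ⟨hy, ?_⟩)
  refine eq_zero_of_mem_affineSpan (S := insert x (zeroFace P g)) ?_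
    (hsp ▸ mem_affineSpan ℝ hy)
  rintro z (rfl | hz)
  exacts [h0, hz.2]

/-! ### Polytopes and their vertices -/

theorem IsPolytope.convex {P : Set (E d)} (hP : IsPolytope P) : Convex ℝ P := by
  obtain ⟨s, rfl⟩ := hP
  exact convex_convexHull ℝ _

theorem IsPolytope.isCompact {P : Set (E d)} (hP : IsPolytope P) : IsCompact P := by
  obtain ⟨s, rfl⟩ := hP
  exact s.finite_toSet.isCompact_convexHull ℝ

theorem convexHull_extremePoints_eq {P : Set (E d)} (hc : IsCompact P) (hP : Convex ℝ P)
    (hfin : (P.extremePoints ℝ).Finite) : convexHull ℝ (P.extremePoints ℝ) = P := by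
  rw [← (hfin.isClosed_convexHull ℝ).closure_eq, closure_convexHull_extremePoints hc hP]

theorem IsPolytope.convexHull_vert {P : Set (E d)} (hP : IsPolytope P) :
    convexHull ℝ (vert P : Set (E d)) = P := by
  have h := coe_vert hP
  rw [h]
  exact convexHull_extremePoints_eq hP.isCompact hP.convex (h ▸ (vert P).finite_toSet)

theorem IsPolytope.mem_of_mem_vert {P : Set (E d)} (hP : IsPolytope P) {v : E d}
    (hv : v ∈ vert P) : v ∈ P := by
  rw [← hP.convexHull_vert]
  exact subset_convexHull ℝ _ hv

theorem IsPolytope.vert_nonempty {P : Set (E d)} (hP : IsPolytope P) (hne : P.Nonempty) :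
    (vert P).Nonempty := by
  rwa [← hP.convexHull_vert, convexHull_nonempty_iff, Finset.coe_nonempty] at hne

theorem IsPolytope.dim_vert {P : Set (E d)} (hP : IsPolytope P) :
    dim (vert P : Set (E d)) = dim P := by
  rw [← dim_convexHull, hP.convexHull_vert]

theorem IsPolytope.affineSpan_vert {P : Set (E d)} (hP : IsPolytope P) :
    affineSpan ℝ (vert P : Set (E d)) = affineSpan ℝ P := by
  rw [← affineSpan_convexHull, hP.convexHull_vert]

theorem IsPolytope.isPolytope_of_isFace {P F : Set (E d)} (hP : IsPolytope P) (hF : IsFace P F) :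
    IsPolytope F := by
  have hfin : (F.extremePoints ℝ).Finite := by
    refine Set.Finite.subset (coe_vert hP ▸ (vert P).finite_toSet) ?_
    exact hF.isExtreme.extremePoints_subset_extremePoints
  refine ⟨hfin.toFinset, ?_⟩
  rw [hfin.coe_toFinset, convexHull_extremePoints_eq (hF.isCompact hP.isCompact)
    (hF.convex hP.convex) hfin]

theorem IsPolytope.mem_vert_iff {P F : Set (E d)} (hP : IsPolytope P) (hF : IsFace P F) {v : E d} :
    v ∈ vert F ↔ v ∈ F ∧ v ∈ vert P := by
  rw [← Finset.mem_coe, ← Finset.mem_coe, coe_vert hP, coe_vert (hP.isPolytope_of_isFace hF),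
    hF.isExtreme.extremePoints_eq]
  rfl

theorem IsPolytope.nonneg_of_nonneg_vert {P : Set (E d)} (hP : IsPolytope P) {g : E d →ᵃ[ℝ] ℝ}
    (hg : ∀ v ∈ vert P, 0 ≤ g v) : ∀ x ∈ P, 0 ≤ g x := by
  intro x hx
  rw [← hP.convexHull_vert] at hx
  exact convexHull_min (s := (vert P : Set (E d))) (t := g ⁻¹' Set.Ici 0) hg
    ((convex_Ici (0 : ℝ)).affine_preimage g) hx

theorem IsPolytope.exists_vert_pos {P : Set (E d)} (hP : IsPolytope P) {g : E d →ᵃ[ℝ] ℝ}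
    (hg : ∀ x ∈ P, 0 ≤ g x) (h : zeroFace P g ≠ P) : ∃ v ∈ vert P, 0 < g v := by
  by_contra! hcon
  refine h ((zeroFace_subset P g).antisymm fun x hx => ⟨hx, ?_⟩)
  refine eq_zero_of_mem_affineSpan (S := vert P)
    (fun v hv => le_antisymm (hcon v hv) (hg v (hP.mem_of_mem_vert hv))) ?_
  rw [hP.affineSpan_vert]
  exact mem_affineSpan ℝ hx

/-- A polytope has a relative interior point, here characterized by lying in no proper face. -/
theorem IsPolytope.exists_relint {P : Set (E d)} (hP : IsPolytope P) (hne : P.Nonempty) :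
    ∃ o ∈ P, ∀ g : E d →ᵃ[ℝ] ℝ, (∀ x ∈ P, 0 ≤ g x) → g o = 0 → zeroFace P g = P := by
  have hV := hP.vert_nonempty hne
  have hc : (0 : ℝ) < (vert P).card := by exact_mod_cast hV.card_pos
  have hsum : ∑ _v ∈ vert P, ((vert P).card : ℝ)⁻¹ = 1 := by
    rw [Finset.sum_const, nsmul_eq_mul, mul_inv_cancel₀ hc.ne']
  refine ⟨∑ v ∈ vert P, ((vert P).card : ℝ)⁻¹ • v,
    hP.convex.sum_mem (fun _ _ => (inv_pos.2 hc).le) hsum (fun v hv => hP.mem_of_mem_vert hv),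
    fun g hg h0 => ?_⟩
  have hlin : ∀ y, g y = g.linear y + g 0 := fun y => by
    have := linear_sub g y 0
    rw [sub_zero] at this
    linarith
  have hval : g (∑ v ∈ vert P, ((vert P).card : ℝ)⁻¹ • v)
      = ∑ v ∈ vert P, ((vert P).card : ℝ)⁻¹ * g v := by
    rw [hlin, map_sum, Finset.sum_congr rfl fun v _ => congrArg _ (hlin v)]
    simp_rw [mul_add, Finset.sum_add_distrib, ← Finset.sum_mul, hsum, map_smul, smul_eq_mul,
      one_mul]
  by_contra hcon
  obtain ⟨v, hv, hpos⟩ := hP.exists_vert_pos hg hcon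
  have : 0 < ∑ v ∈ vert P, ((vert P).card : ℝ)⁻¹ * g v :=
    Finset.sum_pos' (fun w hw => mul_nonneg (inv_pos.2 hc).le (hg w (hP.mem_of_mem_vert hw)))
      ⟨v, hv, mul_pos (inv_pos.2 hc) hpos⟩
  linarith

theorem IsPolytope.exists_add_smul_notMem {P : Set (E d)} (hP : IsPolytope P) (p : E d) {v : E d}
    (hv : v ≠ 0) : ∃ t : ℝ, 0 ≤ t ∧ p + t • v ∉ P := by
  obtain ⟨C, hC⟩ := hP.isCompact.isBounded.exists_norm_le
  have hv' := norm_pos_iff.2 hv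
  refine ⟨(|C| + ‖p‖ + 1) / ‖v‖, by positivity, fun hmem => ?_⟩
  have h1 := hC _ hmem
  have h2 : ‖((|C| + ‖p‖ + 1) / ‖v‖) • v‖ = |C| + ‖p‖ + 1 := by
    rw [norm_smul, Real.norm_of_nonneg (by positivity), div_mul_cancel₀ _ hv'.ne']
  have h3 := norm_sub_le (p + ((|C| + ‖p‖ + 1) / ‖v‖) • v) p
  rw [add_sub_cancel_left, h2] at h3
  linarith [le_abs_self C]

/-! ### Tilting a supporting hyperplane -/

/-- A small perturbation of a supporting hyperplane in the direction of `m`, where `m` is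
nonnegative on the face, cuts out the face of that face where `m` vanishes. -/
theorem IsPolytope.exists_zeroFace_add_smul_eq {P : Set (E d)} (hP : IsPolytope P)
    {g m : E d →ᵃ[ℝ] ℝ} (hg : ∀ x ∈ P, 0 ≤ g x) (hm : ∀ x ∈ zeroFace P g, 0 ≤ m x) :
    ∃ t : ℝ, 0 < t ∧ (∀ x ∈ P, 0 ≤ (g + t • m) x) ∧
      zeroFace P (g + t • m) = zeroFace (zeroFace P g) m := by
  have hev : ∀ᶠ t : ℝ in nhdsWithin 0 (Set.Ioi 0),
      0 < t ∧ ∀ v ∈ vert P, 0 < g v → 0 < g v + 2 * t * m v := by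
    refine (eventually_mem_nhdsWithin).and ((Finset.eventually_all _).2 fun v _ => ?_)
    by_cases hv : 0 < g v
    · have hcont : Filter.Tendsto (fun t : ℝ => g v + 2 * t * m v) (nhds 0) (nhds (g v)) := by
        have : Continuous fun t : ℝ => g v + 2 * t * m v := by fun_prop
        simpa using this.tendsto 0
      filter_upwards [(hcont.eventually (lt_mem_nhds hv)).filter_mono nhdsWithin_le_nhds]
        with t ht _ using ht
    · exact Filter.Eventually.of_forall fun t h => absurd h hv
  obtain ⟨t, ht, hV⟩ := hev.exists
  -- Twice the perturbation is still nonnegative, so that the perturbed functional vanishes only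
  -- where both `g` and `m` do.
  have h2 : ∀ x ∈ P, 0 ≤ (g + (2 * t) • m) x := by
    refine hP.nonneg_of_nonneg_vert fun v hv => ?_
    have hvP := hP.mem_of_mem_vert hv
    simp only [add_smul_apply]
    rcases (hg v hvP).eq_or_lt with h0 | h0
    · have := hm v ⟨hvP, h0.symm⟩
      rw [← h0]
      positivity
    · exact (hV v hv h0).le
  simp only [add_smul_apply] at h2
  refine ⟨t, ht, fun x hx => ?_, ?_⟩
  · simp only [add_smul_apply]
    linarith [h2 x hx, hg x hx]
  · ext x
    simp only [zeroFace, Set.mem_ofPred_eq, add_smul_apply]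
    constructor
    · rintro ⟨hx, h0⟩
      have hgx : g x = 0 := by linarith [h2 x hx, hg x hx]
      rw [hgx, zero_add] at h0
      exact ⟨⟨hx, hgx⟩, (mul_eq_zero.1 h0).resolve_left ht.ne'⟩
    · rintro ⟨⟨hx, h1⟩, h0⟩
      exact ⟨hx, by rw [h1, h0]; simp⟩

/-- A supporting hyperplane can be tilted in the direction of `b` until it hits a new vertex. -/
theorem IsPolytope.exists_tilt {P : Set (E d)} (hP : IsPolytope P) {g b : E d →ᵃ[ℝ] ℝ}
    (hg : ∀ x ∈ P, 0 ≤ g x) (hgb : ∀ v ∈ vert P, b v < 0 → 0 < g v)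
    (hb : ∃ v ∈ vert P, b v < 0) :
    ∃ t : ℝ, (∀ x ∈ P, 0 ≤ (g + t • b) x) ∧ ∃ v ∈ vert P, b v < 0 ∧ (g + t • b) v = 0 := by
  classical
  obtain ⟨v₀, hv₀, hb₀⟩ := hb
  obtain ⟨v, hv, hmin⟩ := ((vert P).filter fun v => b v < 0).exists_min_image
    (fun v => g v / -b v) ⟨v₀, Finset.mem_filter.2 ⟨hv₀, hb₀⟩⟩
  rw [Finset.mem_filter] at hv
  refine ⟨g v / -b v, hP.nonneg_of_nonneg_vert fun w hw => ?_, v, hv.1, hv.2, ?_⟩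
  · have ht : 0 ≤ g v / -b v := div_nonneg (hgb v hv.1 hv.2).le (by linarith [hv.2])
    simp only [add_smul_apply]
    rcases lt_or_ge (b w) 0 with hbw | hbw
    · have := hmin w (Finset.mem_filter.2 ⟨hw, hbw⟩)
      rw [le_div_iff₀ (by linarith)] at this
      linarith
    · have := hg w (hP.mem_of_mem_vert hw)
      positivity
  · have := hv.2.ne
    simp only [add_smul_apply]
    field_simp
    ring

/-! ### Facets -/

/-- A supporting hyperplane that separates `x` from `P` can be rotated about `x` and the face it
defines, until it defines a facet. -/
theorem IsPolytope.exists_isFacet_of_neg {P : Set (E d)} (hP : IsPolytope P) {g : E d →ᵃ[ℝ] ℝ}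
    (hg : ∀ x ∈ P, 0 ≤ g x) (hne : (zeroFace P g).Nonempty) {x : E d}
    (hx : x ∈ affineSpan ℝ P) (hgx : g x < 0) :
    ∃ h : E d →ᵃ[ℝ] ℝ, (∀ x ∈ P, 0 ≤ h x) ∧ h x < 0 ∧ zeroFace P g ⊆ zeroFace P h ∧
      IsFacet P (zeroFace P h) := by
  classical
  induction hN : ((vert P).filter fun v => g v ≠ 0).card using Nat.strong_induction_on
    generalizing g with
  | _ N ih =>
    subst hN
    have hproper : zeroFace P g ≠ P := fun h => hgx.ne <|
      eq_zero_of_mem_affineSpan (fun y hy => (h.ge hy).2) hx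
    have hlt := (isFace_zeroFace hg).dim_lt hne hproper
    by_cases hdim : dim (zeroFace P g) + 1 = dim P
    · exact ⟨g, hg, hgx, subset_rfl, isFace_zeroFace hg, hne, hdim⟩
    obtain ⟨v, hv, hvS⟩ : ∃ v ∈ vert P, v ∉ affineSpan ℝ (insert x (zeroFace P g)) := by
      by_contra! hcon
      have hle : affineSpan ℝ P ≤ affineSpan ℝ (insert x (zeroFace P g)) := by
        rw [← hP.affineSpan_vert]
        exact affineSpan_le.2 hcon
      have h1 : dim P ≤ dim (insert x (zeroFace P g)) := by
        have := Submodule.finrank_mono (AffineSubspace.direction_le hle)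
        rwa [direction_affineSpan, direction_affineSpan] at this
      have h2 := dim_insert_le (zeroFace P g) x
      omega
    obtain ⟨b, hb0, hbv⟩ : ∃ b : E d →ᵃ[ℝ] ℝ,
        (∀ y ∈ insert x (zeroFace P g), b y = 0) ∧ b v < 0 := by
      obtain ⟨b, hb0, hbv⟩ := exists_affineMap_eq_zero_of_notMem (Set.insert_nonempty _ _) hvS
      rcases hbv.lt_or_gt with h | h
      · exact ⟨b, hb0, h⟩
      · exact ⟨-b, fun y hy => by simp [hb0 y hy], by simpa using h⟩
    obtain ⟨t, hnn, w, hw, hbw, hw0⟩ := hP.exists_tilt hg (b := b) (fun u hu hbu => by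
      have huP := hP.mem_of_mem_vert hu
      refine (hg u huP).lt_of_ne fun h0 => ?_
      rw [hb0 u (Or.inr ⟨huP, h0.symm⟩)] at hbu
      exact lt_irrefl _ hbu) ⟨v, hv, hbv⟩
    have hsub : zeroFace P g ⊆ zeroFace P (g + t • b) := fun y hy =>
      ⟨hy.1, by simp [hy.2, hb0 y (Or.inr hy)]⟩
    have hgw : g w ≠ 0 := fun h0 => by
      rw [hb0 w (Or.inr ⟨hP.mem_of_mem_vert hw, h0⟩)] at hbw
      exact lt_irrefl _ hbw
    have hcard : ((vert P).filter fun v => (g + t • b) v ≠ 0).card <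
        ((vert P).filter fun v => g v ≠ 0).card := by
      refine Finset.card_lt_card ((Finset.ssubset_iff_of_subset fun u hu => ?_).2
        ⟨w, Finset.mem_filter.2 ⟨hw, hgw⟩, fun h => (Finset.mem_filter.1 h).2 hw0⟩)
      rw [Finset.mem_filter] at hu ⊢
      exact ⟨hu.1, fun h0 => hu.2 (hsub ⟨hP.mem_of_mem_vert hu.1, h0⟩).2⟩
    obtain ⟨h, h1, h2, h3, h4⟩ := ih _ hcard hnn (hne.mono hsub)
      (by simpa [hb0 x (Or.inl rfl)] using hgx) rfl
    exact ⟨h, h1, h2, hsub.trans h3, h4⟩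

/-- A polytope is cut out of its affine hull by its facet-defining inequalities. -/
theorem IsPolytope.exists_isFacet_of_notMem {P : Set (E d)} (hP : IsPolytope P)
    (hne : P.Nonempty) {x : E d} (hx : x ∈ affineSpan ℝ P) (hxP : x ∉ P) :
    ∃ F, IsFacet P F ∧
      ∀ g : E d →ᵃ[ℝ] ℝ, (∀ y ∈ P, 0 ≤ g y) → zeroFace P g = F → g x < 0 := by
  obtain ⟨f, u, hfx, hfP⟩ :=
    geometric_hahn_banach_point_closed hP.convex hP.isCompact.isClosed hxP
  obtain ⟨p, hp, hmin⟩ := hP.isCompact.exists_isMinOn hne f.continuous.continuousOn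
  have hval : ∀ y, ((f : E d →ₗ[ℝ] ℝ).toAffineMap - AffineMap.const ℝ (E d) (f p)) y
      = f y - f p := fun y => by simp
  obtain ⟨h, h1, h2, -, h4⟩ := hP.exists_isFacet_of_neg
    (g := (f : E d →ₗ[ℝ] ℝ).toAffineMap - AffineMap.const ℝ (E d) (f p))
    (fun y hy => by rw [hval]; linarith [isMinOn_iff.1 hmin y hy])
    ⟨p, hp, by rw [hval, sub_self]⟩ hx (by rw [hval]; linarith [hfP p hp])
  refine ⟨_, h4, fun g hg hgF => ?_⟩
  obtain ⟨z, hz, hhz⟩ := hP.exists_vert_pos h1 h4.ne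
  have hzP := hP.mem_of_mem_vert hz
  have hgz : 0 < g z := (hg z hzP).lt_of_ne fun h0 =>
    hhz.ne' (hgF.le (show z ∈ zeroFace P g from ⟨hzP, h0.symm⟩)).2
  have := mul_apply_eq_mul_apply h4.2.1 h4.1.subset h4.2.2.ge (fun y hy => hy.2)
    (fun y hy => (hgF.ge hy).2) (mem_affineSpan ℝ hzP) hhz.ne' hx
  by_contra! hcon
  nlinarith [mul_pos hgz (neg_pos.2 h2), mul_nonneg hhz.le hcon]

theorem IsPolytope.exists_isFacet_superset {P F : Set (E d)} (hP : IsPolytope P) (hF : IsFace P F)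
    (hne : F.Nonempty) (hFP : F ≠ P) : ∃ G, IsFacet P G ∧ F ⊆ G := by
  obtain ⟨g, hg, rfl⟩ := hF.exists_eq_zeroFace hne
  obtain ⟨v, hv, hgv⟩ := hP.exists_vert_pos hg hFP
  obtain ⟨r, hr⟩ := hne
  have hvP := hP.mem_of_mem_vert hv
  -- The reflection of `v` in a point `r` of the face lies beyond the supporting hyperplane.
  obtain ⟨h, -, -, h3, h4⟩ := hP.exists_isFacet_of_neg hg ⟨r, hr⟩
    (add_smul_mem_affineSpan (mem_affineSpan ℝ hr.1) (vsub_mem_vectorSpan ℝ hvP hr.1) (-1))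
    (by rw [map_add_smul, vsub_eq_sub, linear_sub, hr.2]; linarith)
  exact ⟨_, h4, h3⟩

/-! ### The two facets through a ridge -/

theorem IsPolytope.exists_isFacet_inter_eq {P F R : Set (E d)} (hP : IsPolytope P)
    (hF : IsFacet P F) (hR : IsFacet F R) : ∃ K, IsFacet P K ∧ K ≠ F ∧ F ∩ K = R := by
  obtain ⟨g, hg, rfl⟩ := hF.1.exists_eq_zeroFace hF.2.1
  obtain ⟨m, hm, rfl⟩ := hR.1.exists_eq_zeroFace hR.2.1
  obtain ⟨t, ht, hnn, heq⟩ := hP.exists_zeroFace_add_smul_eq hg hm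
  obtain ⟨v, hv, hgv⟩ := hP.exists_vert_pos hg hF.ne
  obtain ⟨s, hsnn, w, hw, hbw, hw0⟩ := hP.exists_tilt (b := -g) hnn (fun u hu hbu => by
    have huP := hP.mem_of_mem_vert hu
    refine (hnn u huP).lt_of_ne fun h0 => ?_
    have : u ∈ zeroFace P (g + t • m) := ⟨huP, h0.symm⟩
    rw [heq] at this
    have h1 := this.1.2
    have h2 : 0 < g u := by simpa using hbu
    exact h2.ne' h1) ⟨v, hv, by simpa using hgv⟩
  have hgw : 0 < g w := by simpa using hbw
  have hwP := hP.mem_of_mem_vert hw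
  -- On the facet, the tilted functional is the positive multiple `t • m` of `m`.
  have hinter : zeroFace P g ∩ zeroFace P (g + t • m + s • -g) = zeroFace (zeroFace P g) m := by
    ext x
    constructor
    · rintro ⟨hx, -, h0⟩
      refine ⟨hx, ?_⟩
      simpa [hx.2, ht.ne'] using h0
    · rintro ⟨hx, h0⟩
      exact ⟨hx, hx.1, by simp [hx.2, h0]⟩
  have hface := isFace_zeroFace hsnn
  have hRK : zeroFace (zeroFace P g) m ⊆ zeroFace P (g + t • m + s • -g) :=
    hinter ▸ Set.inter_subset_right
  have hKne := hR.2.1.mono hRK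
  refine ⟨_, ⟨hface, hKne, ?_⟩, fun h => hgw.ne' (h.le ⟨hwP, hw0⟩).2, hinter⟩
  have h1 := hface.dim_lt hKne fun h => hR.ne <| by
    rw [← hinter, h]
    exact (Set.inter_eq_left.2 (zeroFace_subset P g))
  have h2 := dim_lt_dim_insert hR.2.1 (x := w) fun h =>
    hgw.ne' (eq_zero_of_mem_affineSpan (fun y hy => hy.1.2) h)
  have h3 := dim_mono (Set.insert_subset (show w ∈ zeroFace P (g + t • m + s • -g) from
    ⟨hwP, hw0⟩) hRK)
  have h4 := hF.2.2
  have h5 := hR.2.2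
  omega

/-- Through a ridge of a facet `F` there is at most one facet other than `F`. -/
theorem IsFacet.eq_of_ridge_subset {P F H K R : Set (E d)} (hF : IsFacet P F) (hH : IsFacet P H)
    (hK : IsFacet P K) (hR : IsFacet F R) (hRH : R ⊆ H) (hRK : R ⊆ K) (hHF : H ≠ F)
    (hKF : K ≠ F) : H = K := by
  have hHF' : ¬ H ⊆ F := fun h => hHF (hH.eq_of_subset hF.1 hF.ne h)
  have hFH' : ¬ F ⊆ H := fun h => hHF (hF.eq_of_subset hH.1 hH.ne h).symm
  have hFK' : ¬ F ⊆ K := fun h => hKF (hF.eq_of_subset hK.1 hK.ne h).symm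
  refine (hK.eq_of_subset hH.1 hH.ne ?_).symm
  obtain ⟨g, hg, rfl⟩ := hF.1.exists_eq_zeroFace hF.2.1
  obtain ⟨h, hh, rfl⟩ := hH.1.exists_eq_zeroFace hH.2.1
  obtain ⟨k, hk, rfl⟩ := hK.1.exists_eq_zeroFace hK.2.1
  obtain ⟨z, hz, hzH⟩ := Set.not_subset.1 hFH'
  obtain ⟨w, hw, hwF⟩ := Set.not_subset.1 hHF'
  have hhz : 0 < h z := (hh z hz.1).lt_of_ne fun h0 => hzH ⟨hz.1, h0.symm⟩
  have hgw : 0 < g w := (hg w hw.1).lt_of_ne fun h0 => hwF ⟨hw.1, h0.symm⟩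
  have hpropF : ∀ x ∈ zeroFace P g, h z * k x = k z * h x := fun x hx =>
    mul_apply_eq_mul_apply hR.2.1 hR.1.subset hR.2.2.ge (fun y hy => (hRH hy).2)
      (fun y hy => (hRK hy).2) (mem_affineSpan ℝ hz) hhz.ne' (mem_affineSpan ℝ hx)
  have hkz : 0 < k z := (hk z hz.1).lt_of_ne fun h0 => hFK' fun x hx => by
    have := hpropF x hx
    rw [← h0, zero_mul] at this
    exact ⟨hx.1, (mul_eq_zero.1 this).resolve_left hhz.ne'⟩
  intro x hx
  -- The combination of `h` and `k` that vanishes on the first facet is a multiple of `g`, and the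
  -- sign of that multiple is read off at `w`.
  have hprop := mul_apply_eq_mul_apply (h := g) (k := h z • k - k z • h) hF.2.1 hF.1.subset
    hF.2.2.ge (fun y hy => hy.2) (fun y hy => by simp [hpropF y hy]) (mem_affineSpan ℝ hw.1)
    hgw.ne' (mem_affineSpan ℝ hx.1)
  have hval : ∀ y, (h z • k - k z • h) y = h z * k y - k z * h y := fun _ => rfl
  rw [hval, hval, hx.2, hw.2] at hprop
  have h1 : 0 ≤ h z * k w * g x := mul_nonneg (mul_nonneg hhz.le (hk w hw.1)) (hg x hx.1)
  have h2 : g w * k z * h x ≤ 0 := by linarith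
  exact ⟨hx.1, le_antisymm (nonpos_of_mul_nonpos_right h2 (mul_pos hgw hkz)) (hh x hx.1)⟩

/-! ### The number of facets -/

theorem nonempty_of_one_le_dim {P : Set (E d)} (hdim : 1 ≤ dim P) : P.Nonempty := by
  by_contra h
  rw [Set.not_nonempty_iff_eq_empty.1 h, dim, vectorSpan_empty, finrank_bot] at hdim
  omega

/-- With too few facets, some direction would increase all the facet-defining functionals, and the
polytope would be unbounded. -/
theorem IsPolytope.dim_lt_card_facets {P : Set (E d)} (hP : IsPolytope P) (hdim : 1 ≤ dim P)
    {𝓕 : Finset (Set (E d))} (h𝓕 : ∀ F, F ∈ 𝓕 ↔ IsFacet P F) : dim P + 1 ≤ 𝓕.card := by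
  classical
  have hne := nonempty_of_one_le_dim hdim
  obtain ⟨p, hp⟩ := hne
  have hpP := mem_affineSpan ℝ hp
  by_contra! hcard
  obtain ⟨F₀, hF₀⟩ : ∃ F₀, IsFacet P F₀ := by
    have : Nontrivial (vectorSpan ℝ P) := Module.finrank_pos_iff.1 hdim
    obtain ⟨w, hw⟩ := exists_ne (0 : vectorSpan ℝ P)
    obtain ⟨t, -, htP⟩ := hP.exists_add_smul_notMem p (v := w) (by simpa using hw)
    obtain ⟨F, hF, -⟩ := hP.exists_isFacet_of_notMem ⟨p, hp⟩
      (add_smul_mem_affineSpan hpP w.2 t) htP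
    exact ⟨F, hF⟩
  have hg : ∀ F, ∃ g : E d →ᵃ[ℝ] ℝ, IsFacet P F → (∀ x ∈ P, 0 ≤ g x) ∧ F = zeroFace P g := by
    intro F
    by_cases hF : IsFacet P F
    · obtain ⟨g, hg⟩ := hF.1.exists_eq_zeroFace hF.2.1
      exact ⟨g, fun _ => hg⟩
    · exact ⟨0, fun h => absurd h hF⟩
  choose g hg using hg
  let φ : vectorSpan ℝ P →ₗ[ℝ] (𝓕.erase F₀ → ℝ) :=
    LinearMap.pi fun F => (g F).linear.comp (vectorSpan ℝ P).subtype
  have hlt : Module.finrank ℝ (𝓕.erase F₀ → ℝ) < Module.finrank ℝ (vectorSpan ℝ P) := by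
    rw [Module.finrank_fintype_fun_eq_card, Fintype.card_coe,
      Finset.card_erase_of_mem ((h𝓕 F₀).2 hF₀)]
    change _ < dim P
    omega
  obtain ⟨w, hw, hw0⟩ := (Submodule.ne_bot_iff _).1 (φ.ker_ne_bot_of_finrank_lt hlt)
  have hker : ∀ F ∈ 𝓕, F ≠ F₀ → (g F).linear w = 0 := fun F hF hne => by
    simpa [φ] using congrFun (LinearMap.mem_ker.1 hw) ⟨F, Finset.mem_erase.2 ⟨hne, hF⟩⟩
  obtain ⟨v, hvP, hv0, hv⟩ : ∃ v ∈ vectorSpan ℝ P, v ≠ 0 ∧ ∀ F ∈ 𝓕, 0 ≤ (g F).linear v := by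
    have hw0' : (w : E d) ≠ 0 := by simpa using hw0
    rcases le_total 0 ((g F₀).linear w) with h | h
    · refine ⟨w, w.2, hw0', fun F hF => ?_⟩
      by_cases hFF : F = F₀
      · rwa [hFF]
      · exact (hker F hF hFF).ge
    · refine ⟨-w, Submodule.neg_mem _ w.2, neg_ne_zero.2 hw0', fun F hF => ?_⟩
      rw [map_neg]
      by_cases hFF : F = F₀
      · rw [hFF]
        linarith
      · rw [hker F hF hFF, neg_zero]
  obtain ⟨t, ht, htP⟩ := hP.exists_add_smul_notMem p hv0
  obtain ⟨F, hF, hneg⟩ := hP.exists_isFacet_of_notMem ⟨p, hp⟩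
    (add_smul_mem_affineSpan hpP hvP t) htP
  have h1 := hneg (g F) (hg F hF).1 (hg F hF).2.symm
  rw [map_add_smul] at h1
  have h2 := (hg F hF).1 p hp
  have h3 := mul_nonneg ht (hv F ((h𝓕 F).2 hF))
  linarith

theorem IsFacet.disjoint_of_dim_eq_one {P F G : Set (E d)} (hdim : dim P = 1) (hF : IsFacet P F)
    (hG : IsFacet P G) (hFG : F ≠ G) {x : E d} (hxF : x ∈ F) : x ∉ G := by
  intro hxG
  have hface : IsFace P (F ∩ G) := hF.1.inter hG.1
  have h1 := hF.2.2
  have h2 := hG.2.2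
  have h3 := hface.eq_of_subset_of_dim_le ⟨x, hxF, hxG⟩ hF.1.subset Set.inter_subset_left
    (by omega)
  have h4 := hface.eq_of_subset_of_dim_le ⟨x, hxF, hxG⟩ hG.1.subset Set.inter_subset_right
    (by omega)
  exact hFG (h3.symm.trans h4)

/-- A segment has at most two facets: of three collinear points, one lies between the others, and
a functional vanishing there cannot be positive at both of them. -/
theorem IsFacet.eq_or_eq_of_dim_eq_one {P F G K : Set (E d)} (hdim : dim P = 1)
    (hF : IsFacet P F) (hG : IsFacet P G) (hK : IsFacet P K) (hFG : F ≠ G) :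
    K = F ∨ K = G := by
  by_contra! hcon
  obtain ⟨x, hx⟩ := hF.2.1
  obtain ⟨y, hy⟩ := hG.2.1
  obtain ⟨z, hz⟩ := hK.2.1
  have hyF := hG.disjoint_of_dim_eq_one hdim hF hFG.symm hy
  have hzF := hK.disjoint_of_dim_eq_one hdim hF hcon.1 hz
  have hzG := hK.disjoint_of_dim_eq_one hdim hG hcon.2 hz
  have hyK := hG.disjoint_of_dim_eq_one hdim hK hcon.2.symm hy
  have hxP := hF.1.subset hx
  obtain ⟨f, hf, rfl⟩ := hF.1.exists_eq_zeroFace hF.2.1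
  obtain ⟨g, hg, rfl⟩ := hG.1.exists_eq_zeroFace hG.2.1
  obtain ⟨k, hk, rfl⟩ := hK.1.exists_eq_zeroFace hK.2.1
  have pos : ∀ {m : E d →ᵃ[ℝ] ℝ} {u : E d}, (∀ v ∈ P, 0 ≤ m v) → u ∈ P → u ∉ zeroFace P m →
      0 < m u := fun hm hu h => (hm _ hu).lt_of_ne fun h0 => h ⟨hu, h0.symm⟩
  have hfy := pos hf hy.1 hyF
  have hfz := pos hf hz.1 hzF
  have hgz := pos hg hz.1 hzG
  have hky := pos hk hy.1 hyK
  have key : ∀ m : E d →ᵃ[ℝ] ℝ, f y * (m z - m x) = (m y - m x) * f z := fun m =>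
    mul_apply_eq_mul_apply (S := {x}) (T := P) (h := f) (k := m - AffineMap.const ℝ (E d) (m x))
      (Set.singleton_nonempty x) (Set.singleton_subset_iff.2 hxP)
      (by rw [hdim]; exact Nat.le_add_left _ _) (by simpa using hx.2) (by simp)
      (mem_affineSpan ℝ hy.1) hfy.ne' (mem_affineSpan ℝ hz.1)
  rcases le_total (f y) (f z) with h | h
  · have h1 := key g
    rw [hy.2] at h1
    nlinarith [mul_pos hfy hgz, mul_nonneg (sub_nonneg.2 h) (hg x hxP)]
  · have h1 := key k
    rw [hz.2] at h1
    nlinarith [mul_pos hfz hky, mul_nonneg (sub_nonneg.2 h) (hk x hxP)]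

/-! ### Connectedness of the facets across ridges -/

/-- A facet is cut out of its affine hull by the inequalities that define its neighbors. -/
theorem IsPolytope.mem_facet_of_nonneg {P F : Set (E d)} (hP : IsPolytope P)
    {𝓕 : Set (Set (E d))} (hfacet : ∀ K ∈ 𝓕, IsFacet P K) (hF : F ∈ 𝓕)
    (hclosed : ∀ R, IsFacet F R → ∃ K ∈ 𝓕, K ≠ F ∧ R ⊆ K) {γ : Set (E d) → E d →ᵃ[ℝ] ℝ}
    (hγ : ∀ K ∈ 𝓕, (∀ x ∈ P, 0 ≤ γ K x) ∧ K = zeroFace P (γ K)) {x : E d}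
    (hx : x ∈ affineSpan ℝ P) (h0 : γ F x = 0) (hnn : ∀ K ∈ 𝓕, 0 ≤ γ K x) : x ∈ F := by
  by_contra hxF
  have hFP := hfacet F hF
  have hxF' : x ∈ affineSpan ℝ F := by
    have h := (hγ F hF).2
    rw [h]
    exact mem_affineSpan_zeroFace (h ▸ hFP) hx h0
  obtain ⟨R, hR, hneg⟩ :=
    (hP.isPolytope_of_isFace hFP.1).exists_isFacet_of_notMem hFP.2.1 hxF' hxF
  obtain ⟨K, hK, hKF, hRK⟩ := hclosed R hR
  refine (hneg (γ K) (fun y hy => (hγ K hK).1 y (hFP.1.subset hy)) ?_).not_ge (hnn K hK)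
  have heq : zeroFace F (γ K) = F ∩ K := by
    conv_rhs => rw [(hγ K hK).2]
    ext y
    exact ⟨fun h => ⟨h.1, hFP.1.subset h.1, h.2⟩, fun h => ⟨h.1, h.2.2⟩⟩
  rw [heq]
  refine (hR.eq_of_subset ((hFP.1.inter (hfacet K hK).1).mono hFP.1.subset
    Set.inter_subset_left) (fun h => hKF ?_) (Set.subset_inter hR.1.subset hRK)).symm
  exact (hFP.eq_of_subset (hfacet K hK).1 (hfacet K hK).ne (Set.inter_eq_left.1 h)).symm

/-- The facets of a polytope are connected through ridges: a nonempty collection of facets that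
contains, for each ridge of each of its members, another facet through that ridge consists of all
facets. The proof is the simplex method for the polar polytope. For a facet `G` and a point `c`
in its relative interior, let `F` be the member of the collection whose normalized functional is
smallest at `c`. As no neighbor of `F` does better, `c` can be moved to a point of `F` or to an
unbounded ray in `F`, unless `F = G`. -/
theorem IsPolytope.mem_of_isFacet_of_closed {P : Set (E d)} (hP : IsPolytope P)
    (hdim : 2 ≤ dim P) {𝓕 : Finset (Set (E d))} (hne : 𝓕.Nonempty)
    (hfacet : ∀ F ∈ 𝓕, IsFacet P F)
    (hclosed : ∀ F ∈ 𝓕, ∀ R, IsFacet F R → ∃ K ∈ 𝓕, K ≠ F ∧ R ⊆ K) {G : Set (E d)}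
    (hG : IsFacet P G) : G ∈ 𝓕 := by
  obtain ⟨o, ho, hrel⟩ := hP.exists_relint (nonempty_of_one_le_dim (by omega : 1 ≤ dim P))
  have hγ : ∀ K, ∃ g : E d →ᵃ[ℝ] ℝ, IsFacet P K →
      (∀ x ∈ P, 0 ≤ g x) ∧ K = zeroFace P g ∧ g o = 1 := by
    intro K
    by_cases hK : IsFacet P K
    · obtain ⟨g, hg, hKg⟩ := hK.1.exists_eq_zeroFace hK.2.1
      have hgo : 0 < g o := (hg o ho).lt_of_ne fun h0 => hK.ne (hKg.trans (hrel g hg h0.symm))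
      have hval : ∀ y, ((g o)⁻¹ • g) y = (g o)⁻¹ * g y := fun _ => rfl
      refine ⟨(g o)⁻¹ • g, fun _ => ⟨fun x hx => ?_, ?_, ?_⟩⟩
      · rw [hval]
        exact mul_nonneg (inv_pos.2 hgo).le (hg x hx)
      · rw [hKg]
        ext y
        simp [zeroFace, hgo.ne', hval]
      · rw [hval, inv_mul_cancel₀ hgo.ne']
    · exact ⟨0, fun h => absurd h hK⟩
  choose γ hγ using hγ
  obtain ⟨c, hcG, hcrel⟩ := (hP.isPolytope_of_isFace hG.1).exists_relint hG.2.1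
  have hcP := hG.1.subset hcG
  obtain ⟨F, hF, hmin⟩ := 𝓕.exists_min_image (fun K => γ K c) hne
  have hFP := hfacet F hF
  obtain ⟨hFnn, hFeq, hFo⟩ := hγ F hFP
  obtain ⟨hGnn, hGeq, hGo⟩ := hγ G hG
  by_contra hG𝓕
  have hGF : G ≠ F := fun h => hG𝓕 (h ▸ hF)
  have hcF : 0 < γ F c := by
    refine (hFnn c hcP).lt_of_ne fun h0 => hGF ?_
    refine hG.eq_of_subset hFP.1 hFP.ne fun y hy => ?_
    rw [← hcrel (γ F) (fun y hy => hFnn y (hG.1.subset hy)) h0.symm] at hy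
    rw [hFeq]
    exact ⟨hG.1.subset hy.1, hy.2⟩
  have hmemF : ∀ x ∈ affineSpan ℝ P, γ F x = 0 → (∀ K ∈ 𝓕, 0 ≤ γ K x) → x ∈ F :=
    fun x hx h0 hnn => hP.mem_facet_of_nonneg (𝓕 := 𝓕) hfacet hF (hclosed F hF)
      (fun K hK => ⟨(hγ K (hfacet K hK)).1, (hγ K (hfacet K hK)).2.1⟩) hx h0 hnn
  have hGc : γ G c = 0 := (hGeq.le hcG).2
  have hcod : c - o ∈ vectorSpan ℝ P := vsub_mem_vectorSpan ℝ hcP ho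
  rcases lt_or_ge (γ F c) 1 with hs | hs
  · -- The point where the ray from `o` through `c` meets the hyperplane of `F` lies in `F`, hence
    -- in `P`, although it is beyond `c`.
    have hs' : 0 < 1 - γ F c := by linarith
    have hval : ∀ K, IsFacet P K →
        γ K (o + (1 - γ F c)⁻¹ • (c - o)) = (γ K c - γ F c) / (1 - γ F c) := fun K hK => by
      rw [map_add_smul, linear_sub, (hγ K hK).2.2]
      field_simp
      ring
    have hmem := hmemF _ (add_smul_mem_affineSpan (mem_affineSpan ℝ ho) hcod _)
      (by rw [hval F hFP, sub_self, zero_div])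
      (fun K hK => by
        rw [hval K (hfacet K hK)]
        exact div_nonneg (sub_nonneg.2 (hmin K hK)) hs'.le)
    have := hGnn _ (hFP.1.subset hmem)
    rw [hval G hG, hGc, zero_sub] at this
    exact absurd this (not_le.2 (div_neg_of_neg_of_pos (neg_neg_of_pos hcF) hs'))
  · -- The facet is unbounded in the direction `(c - o) + (γ F c - 1) • (z - o)` unless that
    -- direction vanishes.
    have hzero : ∀ z ∈ F, c - o + (γ F c - 1) • (z - o) = 0 := by
      intro z hz
      have hzP := hFP.1.subset hz
      by_contra hv0
      obtain ⟨t, ht, htF⟩ :=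
        (hP.isPolytope_of_isFace hFP.1).exists_add_smul_notMem z hv0
      have hval : ∀ K, IsFacet P K →
          γ K (z + t • (c - o + (γ F c - 1) • (z - o)))
            = γ K z + t * ((γ K c - γ F c) + (γ F c - 1) * γ K z) := fun K hK => by
        rw [map_add_smul, map_add, map_smul, linear_sub, linear_sub, (hγ K hK).2.2, smul_eq_mul]
        ring
      refine htF (hmemF _ (add_smul_mem_affineSpan (mem_affineSpan ℝ hzP)
        (Submodule.add_mem _ hcod (Submodule.smul_mem _ _ (vsub_mem_vectorSpan ℝ hzP ho))) t)
        ?_ fun K hK => ?_)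
      · rw [hval F hFP, (hFeq.le hz).2]
        ring
      · rw [hval K (hfacet K hK)]
        have h1 := (hγ K (hfacet K hK)).1 z hzP
        have h2 := sub_nonneg.2 (hmin K hK)
        have h3 := sub_nonneg.2 hs
        positivity
    -- As the facet has two distinct points, `c` would be the interior point `o`.
    obtain ⟨z, hz, z', hz', hzz⟩ : F.Nontrivial := by
      by_contra h
      have h0 : dim F = 0 := by
        rw [dim, vectorSpan_of_subsingleton ℝ (Set.not_nontrivial_iff.1 h), finrank_bot]
      have := hFP.2.2
      omega
    have h1 := hzero z hz
    have h2 := hzero z' hz'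
    have h3 : (γ F c - 1) • (z - z') = 0 := by
      have : (γ F c - 1) • (z - z')
          = (c - o + (γ F c - 1) • (z - o)) - (c - o + (γ F c - 1) • (z' - o)) := by
        module
      rw [this, h1, h2, sub_zero]
    have h4 := (smul_eq_zero.1 h3).resolve_right (sub_ne_zero.2 hzz)
    rw [h4, zero_smul, add_zero, sub_eq_zero] at h1
    rw [h1, hGo] at hGc
    exact one_ne_zero hGc

/-! ### The algorithm -/

theorem IsPolytope.vert_subset_vert_iff {P F G : Set (E d)} (hP : IsPolytope P) (hF : IsFace P F)
    (hG : IsFace P G) : vert F ⊆ vert G ↔ F ⊆ G := by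
  constructor
  · intro h
    rw [← (hP.isPolytope_of_isFace hF).convexHull_vert,
      ← (hP.isPolytope_of_isFace hG).convexHull_vert]
    exact convexHull_mono (Finset.coe_subset.2 h)
  · intro h v hv
    rw [hP.mem_vert_iff hF] at hv
    exact (hP.mem_vert_iff hG).2 ⟨h hv.1, hv.2⟩

theorem IsPolytope.vert_inj {P F G : Set (E d)} (hP : IsPolytope P) (hF : IsFace P F)
    (hG : IsFace P G) : vert F = vert G ↔ F = G := by
  rw [Finset.Subset.antisymm_iff, hP.vert_subset_vert_iff hF hG, hP.vert_subset_vert_iff hG hF,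
    Set.Subset.antisymm_iff]

theorem IsPolytope.vert_inter [DecidableEq (E d)] {P F G : Set (E d)} (hP : IsPolytope P)
    (hF : IsFace P F) (hG : IsFace P G) : vert (F ∩ G) = vert F ∩ vert G := by
  ext v
  have hFG : IsFace P (F ∩ G) := hF.inter hG
  rw [hP.mem_vert_iff hFG, Finset.mem_inter, hP.mem_vert_iff hF, hP.mem_vert_iff hG,
    Set.mem_inter_iff]
  tauto

open Classical in
/-- The collection `{F ∩ G | F ∼ G}` for faces given as sets of points rather than by their
vertices. -/
noncomputable def faceTraces (𝓕 : Finset (Set (E d))) (F : Set (E d)) : Finset (Set (E d)) :=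
  (𝓕.filter fun G => F ≠ G ∧ ¬ ∃ K ∈ 𝓕, K ≠ F ∧ K ≠ G ∧ F ∩ G ⊆ K).image fun G => F ∩ G

theorem mem_faceTraces {𝓕 : Finset (Set (E d))} {F R : Set (E d)} :
    R ∈ faceTraces 𝓕 F ↔
      ∃ G ∈ 𝓕, F ≠ G ∧ (∀ K ∈ 𝓕, F ∩ G ⊆ K → K = F ∨ K = G) ∧ F ∩ G = R := by
  simp only [faceTraces, Finset.mem_image, Finset.mem_filter, and_assoc]
  refine exists_congr fun G => and_congr_right fun _ => and_congr_right fun _ =>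
    and_congr_left fun _ => ?_
  constructor
  · intro h K hK hsub
    by_contra! hcon
    exact h ⟨K, hK, hcon.1, hcon.2, hsub⟩
  · rintro h ⟨K, hK, h1, h2, hsub⟩
    exact (h K hK hsub).elim h1 h2

theorem mem_vertSets {𝓕 : Finset (Set (E d))} {V : Finset (E d)} :
    V ∈ vertSets 𝓕 ↔ ∃ F ∈ 𝓕, vert F = V :=
  Finset.mem_image

theorem IsPolytope.adj_vertSets_iff [DecidableEq (E d)] {P : Set (E d)} (hP : IsPolytope P)
    {𝓕 : Finset (Set (E d))} (hface : ∀ F ∈ 𝓕, IsFace P F) {F G : Set (E d)} (hF : F ∈ 𝓕)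
    (hG : G ∈ 𝓕) : Adj (vertSets 𝓕) (vert F) (vert G) ↔
      F ≠ G ∧ ¬ ∃ K ∈ 𝓕, K ≠ F ∧ K ≠ G ∧ F ∩ G ⊆ K := by
  have hF' := hface F hF
  have hG' := hface G hG
  have hFG : IsFace P (F ∩ G) := hF'.inter hG'
  simp only [Adj, vertSets, Finset.exists_mem_image, ne_eq, hP.vert_inj hF' hG',
    ← hP.vert_inter hF' hG']
  refine and_congr_right fun _ => not_congr <| exists_congr fun K => and_congr_right fun hK => ?_
  rw [hP.vert_inj (hface K hK) hF', hP.vert_inj (hface K hK) hG',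
    hP.vert_subset_vert_iff hFG (hface K hK)]

theorem IsPolytope.traces_vertSets [DecidableEq (E d)] {P : Set (E d)} (hP : IsPolytope P)
    {𝓕 : Finset (Set (E d))} (hface : ∀ F ∈ 𝓕, IsFace P F) {F : Set (E d)} (hF : F ∈ 𝓕) :
    traces (vertSets 𝓕) (vert F) = vertSets (faceTraces 𝓕 F) := by
  have hF' := hface F hF
  -- The definition of `traces` decides equality classically, whatever the ambient instance is.
  have hadj := fun (inst : DecidableEq (E d)) G (hG : G ∈ 𝓕) => hP.adj_vertSets_iff hface hF hG
  have hinter := fun (inst : DecidableEq (E d)) G (hG : G ∈ 𝓕) => hP.vert_inter hF' (hface G hG)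
  ext s
  rw [mem_vertSets]
  simp only [traces, faceTraces, Finset.mem_image, Finset.mem_filter, mem_vertSets]
  constructor
  · rintro ⟨_, ⟨⟨G, hG, rfl⟩, hA⟩, rfl⟩
    exact ⟨F ∩ G, ⟨G, ⟨hG, (hadj _ G hG).1 hA⟩, rfl⟩, hinter _ G hG⟩
  · rintro ⟨_, ⟨G, ⟨hG, hA⟩, rfl⟩, rfl⟩
    exact ⟨vert G, ⟨⟨G, hG, rfl⟩, (hadj _ G hG).2 hA⟩, (hinter _ G hG).symm⟩

theorem isAntichain_faceTraces (𝓕 : Finset (Set (E d))) (F : Set (E d)) :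
    IsAntichain (· ⊆ ·) (faceTraces 𝓕 F : Set (Set (E d))) := by
  intro R hR R' hR' hne hsub
  obtain ⟨G, -, hFG, hG, rfl⟩ := mem_faceTraces.1 hR
  obtain ⟨G', hG', hFG', -, rfl⟩ := mem_faceTraces.1 hR'
  rcases hG G' hG' (hsub.trans Set.inter_subset_right) with h | h
  · exact hFG' h.symm
  · exact hne (by rw [h])

/-- The traces are legitimate input for the recursive call. -/
theorem faceTraces_spec {P : Set (E d)} {𝓕 : Finset (Set (E d))} (hface : ∀ F ∈ 𝓕, IsFace P F)
    (hanti : IsAntichain (· ⊆ ·) (𝓕 : Set (Set (E d)))) (hcard : 2 < 𝓕.card) {F : Set (E d)}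
    (hF : F ∈ 𝓕) : ∀ R ∈ faceTraces 𝓕 F, IsFace F R ∧ R.Nonempty ∧ R ≠ F := by
  classical
  intro R hR
  obtain ⟨G, hG, hFG, hK, rfl⟩ := mem_faceTraces.1 hR
  refine ⟨((hface F hF).inter (hface G hG)).mono (hface F hF).subset Set.inter_subset_left, ?_,
    fun h => hanti hF hG hFG (Set.inter_eq_left.1 h)⟩
  by_contra hempty
  obtain ⟨K, hKF, hKn⟩ := Finset.exists_mem_notMem_of_card_lt_card
    ((Finset.card_le_two (a := F) (b := G)).trans_lt hcard)
  rw [Set.not_nonempty_iff_eq_empty] at hempty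
  exact hKn (by simpa using hK K hKF (hempty ▸ Set.empty_subset K))

/-- In the collection of all facets, the traces on a facet are the ridges in it. -/
theorem IsPolytope.mem_faceTraces_iff {P : Set (E d)} (hP : IsPolytope P)
    {𝓕 : Finset (Set (E d))} (h𝓕 : ∀ F, F ∈ 𝓕 ↔ IsFacet P F) (hcard : 2 < 𝓕.card)
    {F : Set (E d)} (hF : F ∈ 𝓕) {R : Set (E d)} : R ∈ faceTraces 𝓕 F ↔ IsFacet F R := by
  have hFP := (h𝓕 F).1 hF
  constructor
  · intro hR
    obtain ⟨hface, hne, hRF⟩ := faceTraces_spec (fun K hK => ((h𝓕 K).1 hK).1)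
      (fun A hA B hB hAB hsub => hAB <| ((h𝓕 A).1 hA).eq_of_subset ((h𝓕 B).1 hB).1
        ((h𝓕 B).1 hB).ne hsub) hcard hF R hR
    obtain ⟨G, hG, hFG, hK, rfl⟩ := mem_faceTraces.1 hR
    obtain ⟨S, hS, hsub⟩ :=
      (hP.isPolytope_of_isFace hFP.1).exists_isFacet_superset hface hne hRF
    obtain ⟨K, hKP, hKF, rfl⟩ := hP.exists_isFacet_inter_eq hFP hS
    obtain rfl := (hK K ((h𝓕 K).2 hKP) (hsub.trans Set.inter_subset_right)).resolve_left hKF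
    exact hS
  · intro hR
    obtain ⟨G, hGP, hGF, rfl⟩ := hP.exists_isFacet_inter_eq hFP hR
    refine mem_faceTraces.2 ⟨G, (h𝓕 G).2 hGP, hGF.symm, fun K hK hsub => ?_, rfl⟩
    by_contra! hcon
    exact hcon.2 (hFP.eq_of_ridge_subset ((h𝓕 K).1 hK) hGP hR hsub Set.inter_subset_right
      hcon.1 hGF)

theorem Verdict.ne_reject_iff {r : Verdict} : r ≠ .reject ↔ r = .accept := by
  cases r <;> simp

/-- Correctness in dimension one, where a collection of two facets is complete. -/
theorem IsPolytope.card_eq_two_iff {P : Set (E d)} (hP : IsPolytope P) (hdim : dim P = 1)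
    {𝓕 : Finset (Set (E d))} (hface : ∀ F ∈ 𝓕, IsFace P F ∧ F.Nonempty ∧ F ≠ P) :
    𝓕.card = 2 ↔ ∀ F, F ∈ 𝓕 ↔ IsFacet P F := by
  constructor
  · intro h
    obtain ⟨F, G, hFG, rfl⟩ := Finset.card_eq_two.1 h
    have hfacet : ∀ K ∈ ({F, G} : Finset (Set (E d))), IsFacet P K := fun K hK => by
      obtain ⟨h1, h2, h3⟩ := hface K hK
      have := h1.dim_lt h2 h3
      exact ⟨h1, h2, by omega⟩
    refine fun K => ⟨hfacet K, fun hK => ?_⟩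
    simpa using (hfacet F (by simp)).eq_or_eq_of_dim_eq_one hdim (hfacet G (by simp)) hK hFG
  · intro h
    have h1 := hP.dim_lt_card_facets hdim.ge h
    by_contra hne
    obtain ⟨F, hF, G, hG, K, hK, hFG, hFK, hGK⟩ := Finset.two_lt_card.1 (by omega : 2 < 𝓕.card)
    rcases ((h F).1 hF).eq_or_eq_of_dim_eq_one hdim ((h G).1 hG) ((h K).1 hK) hFG with h | h
    exacts [hFK h.symm, hGK h.symm]

/-- Correctness in higher dimension, given that the recursive calls on the facets are correct. -/
theorem IsPolytope.forall_faceTraces_iff {P : Set (E d)} (hP : IsPolytope P) (hdim : 2 ≤ dim P)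
    {𝓕 : Finset (Set (E d))} (hface : ∀ F ∈ 𝓕, IsFace P F ∧ F.Nonempty ∧ F ≠ P) :
    (dim P + 1 ≤ 𝓕.card ∧ ∀ F ∈ 𝓕, dim P ≤ dim F + 1 ∧
        ∀ R, R ∈ faceTraces 𝓕 F ↔ IsFacet F R) ↔ ∀ F, F ∈ 𝓕 ↔ IsFacet P F := by
  constructor
  · rintro ⟨hcard, h⟩
    have hfacet : ∀ F ∈ 𝓕, IsFacet P F := fun F hF => by
      obtain ⟨h1, h2, h3⟩ := hface F hF
      have := h1.dim_lt h2 h3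
      exact ⟨h1, h2, by have := (h F hF).1; omega⟩
    refine fun G => ⟨hfacet G, fun hG => ?_⟩
    refine hP.mem_of_isFacet_of_closed hdim (Finset.card_pos.1 (by omega)) hfacet
      (fun F hF R hR => ?_) hG
    obtain ⟨K, hK, hFK, -, rfl⟩ := mem_faceTraces.1 (((h F hF).2 R).2 hR)
    exact ⟨K, hK, hFK.symm, Set.inter_subset_right⟩
  · intro h
    have hcard := hP.dim_lt_card_facets (by omega) h
    exact ⟨hcard, fun F hF => ⟨((h F).1 hF).2.2.ge, fun R =>
      hP.mem_faceTraces_iff h (by omega) hF⟩⟩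

theorem IsPolytope.fsv_eq_accept_iff {P : Set (E d)} (hP : IsPolytope P) (hdim : 1 ≤ dim P)
    {𝓕 : Finset (Set (E d))} (hface : ∀ F ∈ 𝓕, IsFace P F ∧ F.Nonempty ∧ F ≠ P)
    (hanti : IsAntichain (· ⊆ ·) (𝓕 : Set (Set (E d)))) :
    fsv (vert P) (vertSets 𝓕) = .accept ↔ ∀ F, F ∈ 𝓕 ↔ IsFacet P F := by
  classical
  induction hn : dim P using Nat.strong_induction_on generalizing P 𝓕 with
  | _ n ih =>
    subst hn
    have hPP : IsFace P P := IsExposed.refl P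
    have hsub : ∀ V ∈ vertSets 𝓕, V ⊂ vert P := by
      intro V hV
      obtain ⟨F, hF, rfl⟩ := mem_vertSets.1 hV
      obtain ⟨h1, -, h3⟩ := hface F hF
      exact Finset.ssubset_iff_subset_ne.2 ⟨(hP.vert_subset_vert_iff h1 hPP).2 h1.subset,
        fun h => h3 ((hP.vert_inj h1 hPP).1 h)⟩
    have hcardV : (vertSets 𝓕).card = 𝓕.card := Finset.card_image_of_injOn fun F hF G hG h =>
      (hP.vert_inj (hface F hF).1 (hface G hG).1).1 h
    rw [fsv_eq _ _ hsub, hP.dim_vert, hcardV]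
    by_cases h1 : dim P = 1
    · rw [if_pos h1, ← hP.card_eq_two_iff h1 hface]
      split_ifs with h <;> simp [h]
    rw [if_neg h1, ← hP.forall_faceTraces_iff (by omega) hface]
    by_cases hcard : 𝓕.card < dim P + 1
    · rw [if_pos hcard]
      simp only [reduceCtorEq, false_iff, not_and]
      omega
    rw [if_neg hcard]
    have key : ∀ F ∈ 𝓕, ¬ (dim (vert F : Set (E d)) + 1 < dim P ∨
        fsv (vert F) (traces (vertSets 𝓕) (vert F)) = .reject) ↔
        dim P ≤ dim F + 1 ∧ ∀ R, R ∈ faceTraces 𝓕 F ↔ IsFacet F R := by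
      intro F hF
      have hFpoly := hP.isPolytope_of_isFace (hface F hF).1
      rw [not_or, not_lt, hFpoly.dim_vert, ← ne_eq, Verdict.ne_reject_iff,
        hP.traces_vertSets (fun K hK => (hface K hK).1) hF]
      refine and_congr_right fun hdimF => ?_
      exact ih (dim F) ((hface F hF).1.dim_lt (hface F hF).2.1 (hface F hF).2.2) hFpoly
        (by omega) (faceTraces_spec (fun K hK => (hface K hK).1) hanti (by omega) hF)
        (isAntichain_faceTraces 𝓕 F) rfl
    have hiff : (¬ ∃ V ∈ vertSets 𝓕, dim (V : Set (E d)) + 1 < dim P ∨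
        fsv V (traces (vertSets 𝓕) V) = .reject) ↔
        dim P + 1 ≤ 𝓕.card ∧ ∀ F ∈ 𝓕, dim P ≤ dim F + 1 ∧
          ∀ R, R ∈ faceTraces 𝓕 F ↔ IsFacet F R := by
      rw [and_iff_right (not_lt.1 hcard)]
      simp only [not_exists, not_and]
      constructor
      · exact fun h F hF => (key F hF).1 (h _ (Finset.mem_image_of_mem _ hF))
      · intro h V hV
        obtain ⟨F, hF, rfl⟩ := mem_vertSets.1 hV
        exact (key F hF).2 (h F hF)
    rw [← hiff]
    split_ifs with h <;> simp [h]

end FSV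

theorem mainTheorem3 {d : ℕ} (P : Set (FSV.E d)) (hP : FSV.IsPolytope P) (hdim : 1 ≤ FSV.dim P)
    (𝓕 : Finset (Set (FSV.E d)))
    (hface : ∀ F ∈ 𝓕, FSV.IsFace P F ∧ F.Nonempty ∧ F ≠ P)
    (hanti : IsAntichain (· ⊆ ·) (𝓕 : Set (Set (FSV.E d)))) :
    FSV.fsv (FSV.vert P) (FSV.vertSets 𝓕) = FSV.Verdict.accept ↔
      (𝓕 : Set (Set (FSV.E d))) = {F | FSV.IsFacet P F} := by
  rw [hP.fsv_eq_accept_iff hdim hface hanti, Set.ext_iff]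
  rfl
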